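/- A stochastic game with rewards is a tuple $\mathcal{G}=(V,(V_1,V_2,V_{\mathsf P}),\delta,r)$, where $V$ is a finite set of vertices partitioned into $V_1,V_2,V_{\mathsf P}$ (some of which may be empty), $\delta:V\times V\to[0,1]$ satisfies $\delta(v,v')\in\{0,1\}$ for $v\in V_1\cup V_2$ and $\sum_{v'}\delta(v,v')=1$ for $v\in V_{\mathsf P}$, every $v$ has $\mathrm{post}(v)=\{v'\mid\delta(v,v')>0\}\neq\emptyset$, and $r:V\to[0,\infty)$ vanishes on the set $T$ of terminal vertices, i.e. those $v$ with $\delta(v,v)=1$ and $\delta(v,v')=0$ for $v'\ne v$. A path is an infinite sequence $\omega=\omega_0\omega_1\dots$ with $\delta(\omega_k,\omega_{k+1})>0$ for all $k$. A strategy for Player $i\in\{1,2\}$ maps each sequence $\hat\omega v\in V^*V_i$ to a probability distribution on $V$ supported in $\mathrm{post}(v)$; it is deterministic if all these distributions are Dirac, and memoryless if they depend only on $v$. Let $\Pi_i$ be the set of strategies of Player $i$ and $\Pi_1^{DM}\subseteq\Pi_1$ the set of deterministic memoryless ones. A pair $\pi_1\in\Pi_1,\pi_2\in\Pi_2$ and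 an initial vertex $v$ induce a probability measure $\mathbb{P}^{\pi_1,\pi_2}_{v}$ on infinite sequences of vertices, with expectation $\mathbb{E}^{\pi_1,\pi_2}_{v}$. Let $\mathrm{rew}(\omega)=\sum_{i\ge 0}r(\omega_i)\in[0,\infty]$. A path $\omega$ is fair if, for every $u\in V_2$ that occurs infinitely often in $\omega$, every element of $\mathrm{post}(u)$ occurs infinitely often in $\omega$. A strategy $\pi_2\in\Pi_2$ is fair if $\mathbb{P}^{\pi_1,\pi_2}_{v}(\{\omega\mid\omega\text{ is a fair path}\})=1$ for all $\pi_1\in\Pi_1$ and $v\in V$. Let $\Pi_2^{F}$ be the set of fair strategies of Player 2 and $\Pi_2^{DMF}$ the set of its deterministic memoryless elements. The game $\mathcal{G}$ is stopping under fairness if, for all $\pi_1\in\Pi_1$, $\pi_2\in\Pi_2^{F}$ and $v\in V$, a path that visits $T$ occurs with $\mathbb{P}^{\pi_1,\pi_2}_{v}$-probability $1$. Corollary. For every stochastic game with rewards $\mathcal{G}$ that is stopping under fairness and every $v\in V$, $$\sup_{\pi_1\in\Pi_1}\ \inf_{\pi_2\in\Pi_2^{F}}\ \mathbb{E}^{\pi_1,\pi_2}_{v}[\mathrm{rew}]\;=\;\sup_{\pi_1\in\Pi_1^{DM}}\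 \inf_{\pi_2\in\Pi_2^{DMF}}\ \mathbb{E}^{\pi_1,\pi_2}_{v}[\mathrm{rew}],$$ and this common value is finite (expectations, suprema and infima being taken in $[0,\infty]$, with $\inf\emptyset=\infty$). -/

import Mathlib

open MeasureTheory ProbabilityTheory Filter
open scoped ENNReal NNReal

/-- Who controls a vertex: Player 1, Player 2, or chance (a probabilistic vertex). -/
inductive Owner where
  | player1
  | player2
  | chance

/-- A stochastic game with non-negative rewards on the vertex set `V`. The partition of `V` into
`V₁`, `V₂`, `V_P` is given by the fibres of `owner` (each may be empty). -/
structure StochGame (V : Type*) [Fintype V] where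
  owner : V → Owner
  /-- the transition function -/
  δ : V → V → ℝ≥0
  /-- on vertices of a player, `δ` is the indicator of the set of available moves -/
  δ_player : ∀ v, owner v ≠ Owner.chance → ∀ v', δ v v' = 0 ∨ δ v v' = 1
  /-- at probabilistic vertices, `δ` is a probability distribution -/
  δ_chance : ∀ v, owner v = Owner.chance → ∑ v', δ v v' = 1
  /-- every vertex has a successor -/
  post_nonempty : ∀ v, ∃ v', 0 < δ v v'
  reward : V → ℝ≥0
  /-- terminal vertices have reward zero -/
  reward_terminal : ∀ v, (δ v v = 1 ∧ ∀ v', v' ≠ v → δ v v' = 0) → reward v = 0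

namespace StochGame

variable {V : Type*} [Fintype V]

/-- The set of successors of a vertex. -/
def post (G : StochGame V) (v : V) : Set V := {v' | 0 < G.δ v v'}

/-- The set `T` of terminal vertices. -/
def terminal (G : StochGame V) : Set V := {v | G.δ v v = 1 ∧ ∀ v', v' ≠ v → G.δ v v' = 0}

/-- A (randomized, history-dependent) strategy for the player `i`: to a finite sequence `h` of
vertices followed by a vertex `v` owned by `i` it assigns a probability distribution supported on
the successors of `v`. Used with `i = Owner.player1` and `i = Owner.player2`. -/
structure Strategy (G : StochGame V) (i : Owner) where
  dist : List V → {v : V // G.owner v = i} → PMF V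
  dist_support : ∀ h v, (dist h v).support ⊆ G.post v

/-- A strategy is deterministic if all its distributions are Dirac distributions. -/
def Strategy.IsDeterministic {G : StochGame V} {i : Owner} (σ : G.Strategy i) : Prop :=
  ∀ h v, ∃ v', σ.dist h v = PMF.pure v'

/-- A strategy is memoryless if it depends only on the current vertex. -/
def Strategy.IsMemoryless {G : StochGame V} {i : Owner} (σ : G.Strategy i) : Prop :=
  ∀ h v, σ.dist h v = σ.dist [] v

/-- The distribution of the next vertex when the play so far is `h` followed by `v`. -/
noncomputable def step (G : StochGame V) (σ₁ : G.Strategy Owner.player1)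
    (σ₂ : G.Strategy Owner.player2) (h : List V) (v : V) : PMF V :=
  match hv : G.owner v with
  | Owner.player1 => σ₁.dist h ⟨v, hv⟩
  | Owner.player2 => σ₂.dist h ⟨v, hv⟩
  | Owner.chance => PMF.ofFintype (fun v' => (G.δ v v' : ℝ≥0∞)) (by
      rw [← ENNReal.ofNNReal_finsetSum, G.δ_chance v hv, ENNReal.coe_one])

section Measure

variable [MeasurableSpace V] [DiscreteMeasurableSpace V]

/-- The transition kernel at time `n`: the history `x₀ … xₙ` is split into `x₀ … xₙ₋₁` and the
current vertex `xₙ`. -/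
noncomputable def stepKernel (G : StochGame V) (σ₁ : G.Strategy Owner.player1)
    (σ₂ : G.Strategy Owner.player2) (n : ℕ) :
    Kernel (Π _ : Finset.Iic n, V) V where
  toFun x := (G.step σ₁ σ₂
    (List.ofFn fun i : Fin n => x ⟨i, Finset.mem_Iic.2 i.isLt.le⟩)
    (x ⟨n, Finset.mem_Iic.2 le_rfl⟩)).toMeasure
  measurable' := Measurable.of_discrete

instance (G : StochGame V) (σ₁ : G.Strategy Owner.player1) (σ₂ : G.Strategy Owner.player2)
    (n : ℕ) : IsMarkovKernel (G.stepKernel σ₁ σ₂ n) :=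
  ⟨fun _ => PMF.toMeasure.isProbabilityMeasure _⟩

/-- The probability measure on infinite sequences of vertices induced by a pair of strategies and
an initial vertex `v`. -/
noncomputable def prob (G : StochGame V) (σ₁ : G.Strategy Owner.player1)
    (σ₂ : G.Strategy Owner.player2) (v : V) : Measure (ℕ → V) :=
  Kernel.traj (X := fun _ => V) (G.stepKernel σ₁ σ₂) 0 (fun _ => v)

end Measure

/-- The set of (infinite) paths of the game. -/
def paths (G : StochGame V) : Set (ℕ → V) := {ω | ∀ k, 0 < G.δ (ω k) (ω (k + 1))}

/-- The set of vertices that occur infinitely often in a sequence. -/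
def infOften (ω : ℕ → V) : Set V := {v | ∃ᶠ n in atTop, ω n = v}

/-- The set of fair plays for Player 2. -/
def fairPlays (G : StochGame V) : Set (ℕ → V) :=
  {ω | ω ∈ G.paths ∧
    ∀ v', G.owner v' = Owner.player2 → v' ∈ infOften ω → G.post v' ⊆ infOften ω}

/-- The set of paths that reach a terminal vertex. -/
def reachTerminal (G : StochGame V) : Set (ℕ → V) :=
  {ω | ω ∈ G.paths ∧ ∃ i, ω i ∈ G.terminal}

/-- The total accumulated reward of a play. -/
noncomputable def rew (G : StochGame V) (ω : ℕ → V) : ℝ≥0∞ := ∑' i, (G.reward (ω i) : ℝ≥0∞)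

variable [MeasurableSpace V] [DiscreteMeasurableSpace V]

/-- A Player 2 strategy is (almost-sure) fair if, against every Player 1 strategy and from every
vertex, the play is fair with probability one. -/
def Strategy.IsFair {G : StochGame V} (σ₂ : G.Strategy Owner.player2) : Prop :=
  ∀ (σ₁ : G.Strategy Owner.player1) (v : V), G.prob σ₁ σ₂ v G.fairPlays = 1

/-- The game is stopping under fairness. -/
def StoppingUnderFairness (G : StochGame V) : Prop :=
  ∀ (σ₁ : G.Strategy Owner.player1) (σ₂ : G.Strategy Owner.player2), σ₂.IsFair →
    ∀ v : V, G.prob σ₁ σ₂ v G.reachTerminal = 1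

/-- The expected total accumulated reward. -/
noncomputable def expectedRew (G : StochGame V) (σ₁ : G.Strategy Owner.player1)
    (σ₂ : G.Strategy Owner.player2) (v : V) : ℝ≥0∞ :=
  ∫⁻ ω, G.rew ω ∂(G.prob σ₁ σ₂ v)

end StochGame

/-! It suffices to find a finite vector `x` and positional strategies `τ₁`, `τ₂`, with `τ₂` fair,
such that `τ₂` keeps the expected reward at most `x` against everyone and `τ₁` secures at least `x`
against every fair opponent (`exists_saddle`).

Stopping under fairness excludes any nonempty set of nonterminal vertices in which Player 1 can stay
while no other move leaves. This yields a rank function, hence proper positional choices `c` for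
Player 2, whose plays terminate almost surely and are therefore fair. Each such `c` has a finite
best-response value, the least fixed point of its Bellman operator. Among the finitely many proper
choices take one with minimal total value: switching to a strictly better successor preserves
properness (`IsProper.update`) and lowers the total, so no such switch exists and the value `x`
solves the min-max equation.

Thus `x` dominates every reward against `c`. When Player 1 maximises `x` greedily, `x` bounds the
reward from below, since fair play ends in terminal vertices, where `x` vanishes. -/

namespace StochGame

/-! ### One-step transitions and paths. -/

section Step

variable {V : Type*} [Fintype V] (G : StochGame V) (σ₁ : G.Strategy Owner.player1)
  (σ₂ : G.Strategy Owner.player2)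

theorem step_player1 (h : List V) {v : V} (hv : G.owner v = Owner.player1) :
    G.step σ₁ σ₂ h v = σ₁.dist h ⟨v, hv⟩ := by
  unfold step
  split <;> first | rfl | (rename_i hv'; rw [hv] at hv'; cases hv')

theorem step_player2 (h : List V) {v : V} (hv : G.owner v = Owner.player2) :
    G.step σ₁ σ₂ h v = σ₂.dist h ⟨v, hv⟩ := by
  unfold step
  split <;> first | rfl | (rename_i hv'; rw [hv] at hv'; cases hv')

theorem step_chance (h : List V) {v : V} (hv : G.owner v = Owner.chance) (w : V) :
    G.step σ₁ σ₂ h v w = G.δ v w := by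
  unfold step
  split <;> simp_all

theorem step_support (h : List V) (v : V) : (G.step σ₁ σ₂ h v).support ⊆ G.post v := by
  rcases hv : G.owner v with _ | _ | _
  · rw [step_player1 G σ₁ σ₂ h hv]; exact σ₁.dist_support _ _
  · rw [step_player2 G σ₁ σ₂ h hv]; exact σ₂.dist_support _ _
  · intro w hw
    rw [PMF.mem_support_iff, step_chance G σ₁ σ₂ h hv] at hw
    exact pos_iff_ne_zero.2 (by simpa using hw)

/-- The sequences whose every move has positive probability under the given strategies. -/
def consistent : Set (ℕ → V) :=
  {ω | ∀ n, ω (n + 1) ∈ (G.step σ₁ σ₂ (List.ofFn fun i : Fin n => ω i) (ω n)).support}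

variable {G σ₁ σ₂} in
theorem mem_paths_of_consistent {ω : ℕ → V} (hω : ω ∈ G.consistent σ₁ σ₂) : ω ∈ G.paths :=
  fun n => G.step_support σ₁ σ₂ _ _ (hω n)

variable {G} in
theorem terminal_stable {ω : ℕ → V} (hω : ω ∈ G.paths) {n : ℕ} (hn : ω n ∈ G.terminal) {m : ℕ}
    (hm : n ≤ m) : ω m = ω n := by
  induction m, hm using Nat.le_induction with
  | base => rfl
  | succ m _ ih =>
    by_contra hne
    have := hω m
    rw [ih, hn.2 _ hne] at this
    exact lt_irrefl _ this

end Step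

theorem _root_.PMF.sum_coe {V : Type*} [Fintype V] (p : PMF V) : ∑ w, p w = 1 := by
  rw [← tsum_fintype (L := .unconditional V), p.tsum_coe]

theorem _root_.PMF.sum_mul_le_of_support {V : Type*} [Fintype V] (p : PMF V) (f : V → ℝ≥0∞)
    {a : ℝ≥0∞} (h : ∀ w ∈ p.support, f w ≤ a) : ∑ w, p w * f w ≤ a := by
  calc ∑ w, p w * f w ≤ ∑ w, p w * a := by
        refine Finset.sum_le_sum fun w _ => ?_
        by_cases hw : p w = 0
        · simp [hw]
        · gcongr; exact h w hw
    _ = a := by rw [← Finset.sum_mul, p.sum_coe, one_mul]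

theorem _root_.PMF.le_sum_mul_of_support {V : Type*} [Fintype V] (p : PMF V) (f : V → ℝ≥0∞)
    {a : ℝ≥0∞} (h : ∀ w ∈ p.support, a ≤ f w) : a ≤ ∑ w, p w * f w := by
  calc a = ∑ w, p w * a := by rw [← Finset.sum_mul, p.sum_coe, one_mul]
    _ ≤ ∑ w, p w * f w := by
        refine Finset.sum_le_sum fun w _ => ?_
        by_cases hw : p w = 0
        · simp [hw]
        · gcongr; exact h w hw

/-! ### Drift inequalities for the play measure. -/

section Prob

variable {V : Type*} [Fintype V] [MeasurableSpace V] [DiscreteMeasurableSpace V]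
  (G : StochGame V) (σ₁ : G.Strategy Owner.player1) (σ₂ : G.Strategy Owner.player2) (v : V)

instance : IsProbabilityMeasure (G.prob σ₁ σ₂ v) := by
  unfold prob; infer_instance

/-- The law of the first `n + 2` vertices disintegrates into the law of the first `n + 1` and the
step kernel. Letting `F` see the whole history covers strategies with memory. -/
theorem lintegral_prob_succ (n : ℕ) (F : List V → V → V → ℝ≥0∞) :
    ∫⁻ ω, F (List.ofFn fun i : Fin n => ω i) (ω n) (ω (n + 1)) ∂(G.prob σ₁ σ₂ v) =
      ∫⁻ ω, ∑ w, G.step σ₁ σ₂ (List.ofFn fun i : Fin n => ω i) (ω n) w *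
        F (List.ofFn fun i : Fin n => ω i) (ω n) w ∂(G.prob σ₁ σ₂ v) := by
  let Φ : (Π _ : Finset.Iic n, V) × V → ℝ≥0∞ := fun p =>
    F (List.ofFn fun i : Fin n => p.1 ⟨i, Finset.mem_Iic.2 i.isLt.le⟩)
      (p.1 ⟨n, Finset.mem_Iic.2 le_rfl⟩) p.2
  have hΦ : Measurable Φ := Measurable.of_discrete
  have key := Kernel.partialTraj_compProd_eq_map_traj (X := fun _ => V)
    (κ := G.stepKernel σ₁ σ₂) (Nat.zero_le n) (x₀ := fun _ => v)
  have e1 : ∫⁻ ω, F (List.ofFn fun i : Fin n => ω i) (ω n) (ω (n + 1)) ∂(G.prob σ₁ σ₂ v) =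
      ∫⁻ p, Φ p ∂((Kernel.traj (X := fun _ => V) (G.stepKernel σ₁ σ₂) 0 (fun _ => v)).map
        (fun x => (Preorder.frestrictLe n x, x (n + 1)))) := by
    rw [lintegral_map hΦ (by fun_prop)]
    rfl
  rw [e1, ← key, Measure.lintegral_compProd hΦ, ← Kernel.traj_map_frestrictLe_apply,
    lintegral_map Measurable.of_discrete (by fun_prop)]
  refine lintegral_congr fun ω => ?_
  rw [lintegral_fintype]
  refine Finset.sum_congr rfl fun w _ => ?_
  rw [mul_comm]
  congr 1
  change (PMF.toMeasure _) {w} = _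
  rw [PMF.toMeasure_apply_singleton _ _ (MeasurableSet.singleton w)]
  rfl

theorem prob_zero_eq : ∀ᵐ ω ∂(G.prob σ₁ σ₂ v), ω 0 = v := by
  have h := Kernel.traj_map_frestrictLe_apply (X := fun _ => V)
    (κ := G.stepKernel σ₁ σ₂) 0 0 (fun _ => v)
  rw [Kernel.partialTraj_self, Kernel.id_apply] at h
  have h2 : ∀ᵐ x ∂((Kernel.traj (X := fun _ => V) (G.stepKernel σ₁ σ₂) 0 (fun _ => v)).map
      (Preorder.frestrictLe 0)), x ⟨0, Finset.mem_Iic.2 le_rfl⟩ = v := by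
    rw [h, ae_dirac_eq]; simp
  exact ae_of_ae_map (by fun_prop) h2

theorem ae_consistent : ∀ᵐ ω ∂(G.prob σ₁ σ₂ v), ω ∈ G.consistent σ₁ σ₂ := by
  classical
  refine ae_all_iff.2 fun n => ?_
  have h := G.lintegral_prob_succ σ₁ σ₂ v n
    (fun l u w => if w ∈ (G.step σ₁ σ₂ l u).support then 0 else 1)
  have h0 : ∀ l u, ∑ w, G.step σ₁ σ₂ l u w *
      (if w ∈ (G.step σ₁ σ₂ l u).support then (0 : ℝ≥0∞) else 1) = 0 := by
    intro l u
    refine Finset.sum_eq_zero fun w _ => ?_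
    by_cases hw : w ∈ (G.step σ₁ σ₂ l u).support
    · simp [hw]
    · simp [hw, (PMF.apply_eq_zero_iff _ _).2 hw]
  simp only [h0, lintegral_zero] at h
  rw [lintegral_eq_zero_iff] at h
  · filter_upwards [h] with ω hω
    by_contra hc
    simp [hc] at hω
  · exact (Measurable.of_discrete (f := fun p : (Fin n → V) × V × V =>
      if p.2.2 ∈ (G.step σ₁ σ₂ (List.ofFn p.1) p.2.1).support then (0 : ℝ≥0∞) else 1)).comp
      (g := fun p => _) (f := fun ω : ℕ → V => (fun i : Fin n => ω i, ω n, ω (n + 1)))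
      (by fun_prop)

/-- Telescoping: `y (ω n)` plus the reward collected before time `n` is a supermartingale. -/
theorem sum_lintegral_add_le (ρ y : V → ℝ≥0∞)
    (hy : ∀ h u, ρ u + ∑ w, G.step σ₁ σ₂ h u w * y w ≤ y u) (n : ℕ) :
    ∑ i ∈ Finset.range n, ∫⁻ ω, ρ (ω i) ∂(G.prob σ₁ σ₂ v) +
      ∫⁻ ω, y (ω n) ∂(G.prob σ₁ σ₂ v) ≤ y v := by
  induction n with
  | zero =>
    have : ∫⁻ ω, y (ω 0) ∂(G.prob σ₁ σ₂ v) = ∫⁻ _, y v ∂(G.prob σ₁ σ₂ v) :=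
      lintegral_congr_ae (by filter_upwards [G.prob_zero_eq σ₁ σ₂ v] with ω h; rw [h])
    simp [this]
  | succ n ih =>
    refine le_trans ?_ ih
    rw [Finset.sum_range_succ, add_assoc]
    gcongr
    rw [G.lintegral_prob_succ σ₁ σ₂ v n (fun _ _ w => y w), ← lintegral_add_left]
    · exact lintegral_mono fun ω => hy _ _
    · exact Measurable.of_discrete.comp (measurable_pi_apply n)

theorem le_sum_lintegral_add (ρ y : V → ℝ≥0∞)
    (hy : ∀ h u, y u ≤ ρ u + ∑ w, G.step σ₁ σ₂ h u w * y w) (n : ℕ) :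
    y v ≤ ∑ i ∈ Finset.range n, ∫⁻ ω, ρ (ω i) ∂(G.prob σ₁ σ₂ v) +
      ∫⁻ ω, y (ω n) ∂(G.prob σ₁ σ₂ v) := by
  induction n with
  | zero =>
    have : ∫⁻ ω, y (ω 0) ∂(G.prob σ₁ σ₂ v) = ∫⁻ _, y v ∂(G.prob σ₁ σ₂ v) :=
      lintegral_congr_ae (by filter_upwards [G.prob_zero_eq σ₁ σ₂ v] with ω h; rw [h])
    simp [this]
  | succ n ih =>
    refine ih.trans ?_
    rw [Finset.sum_range_succ, add_assoc]
    gcongr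
    rw [G.lintegral_prob_succ σ₁ σ₂ v n (fun _ _ w => y w), ← lintegral_add_left]
    · exact lintegral_mono fun ω => hy _ _
    · exact Measurable.of_discrete.comp (measurable_pi_apply n)

theorem lintegral_tsum_prob (ρ : V → ℝ≥0∞) :
    ∫⁻ ω, ∑' i, ρ (ω i) ∂(G.prob σ₁ σ₂ v) = ∑' i, ∫⁻ ω, ρ (ω i) ∂(G.prob σ₁ σ₂ v) :=
  lintegral_tsum fun i => (Measurable.of_discrete.comp (measurable_pi_apply i)).aemeasurable

theorem lintegral_tsum_le (ρ y : V → ℝ≥0∞)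
    (hy : ∀ h u, ρ u + ∑ w, G.step σ₁ σ₂ h u w * y w ≤ y u) :
    ∫⁻ ω, ∑' i, ρ (ω i) ∂(G.prob σ₁ σ₂ v) ≤ y v := by
  rw [lintegral_tsum_prob]
  refine ENNReal.summable.tsum_le_of_sum_range_le fun n => ?_
  exact le_self_add.trans (G.sum_lintegral_add_le σ₁ σ₂ v ρ y hy n)

theorem ae_reachTerminal (h : G.prob σ₁ σ₂ v G.reachTerminal = 1) :
    ∀ᵐ ω ∂(G.prob σ₁ σ₂ v), ∃ i, ω i ∈ G.terminal := by
  have hm : MeasurableSet {ω : ℕ → V | ∃ i, ω i ∈ G.terminal} := by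
    simp only [Set.ofPred_exists]
    exact MeasurableSet.iUnion fun i => measurable_pi_apply i MeasurableSet.of_discrete
  have : G.prob σ₁ σ₂ v {ω : ℕ → V | ∃ i, ω i ∈ G.terminal} = 1 :=
    le_antisymm prob_le_one (h ▸ measure_mono fun ω hω => hω.2)
  exact (mem_ae_iff_prob_eq_one hm).2 this

variable {G σ₁ σ₂ v} in
theorem prob_eq_one_of_ae {s : Set (ℕ → V)} (h : ∀ᵐ ω ∂(G.prob σ₁ σ₂ v), ω ∈ s) :
    G.prob σ₁ σ₂ v s = 1 := by
  rw [measure_congr (eventuallyEq_univ.2 (show s ∈ ae _ from h)), measure_univ]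

/-- The submartingale bound leaves a remainder `∫ y (ω n)`. It tends to zero by dominated
convergence, since almost every play is eventually constant at a terminal vertex, where `y`
vanishes. -/
theorem le_lintegral_tsum (ρ y : V → ℝ≥0∞) (hfin : ∀ u, y u ≠ ∞)
    (hterm : ∀ u ∈ G.terminal, y u = 0)
    (hreach : G.prob σ₁ σ₂ v G.reachTerminal = 1)
    (hy : ∀ h u, y u ≤ ρ u + ∑ w, G.step σ₁ σ₂ h u w * y w) :
    y v ≤ ∫⁻ ω, ∑' i, ρ (ω i) ∂(G.prob σ₁ σ₂ v) := by
  rw [lintegral_tsum_prob]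
  have h1 : Tendsto (fun n => ∫⁻ ω, y (ω n) ∂(G.prob σ₁ σ₂ v)) atTop (nhds 0) := by
    have := tendsto_lintegral_of_dominated_convergence (μ := G.prob σ₁ σ₂ v)
      (F := fun n ω => y (ω n)) (f := fun _ => 0) (fun _ => ∑ u, y u)
      (fun n => Measurable.of_discrete.comp (measurable_pi_apply n))
      (fun n => Eventually.of_forall fun ω =>
        Finset.single_le_sum (f := y) (fun _ _ => zero_le) (Finset.mem_univ _))
      (by simpa using hfin) ?_
    · simpa using this
    · filter_upwards [G.ae_reachTerminal σ₁ σ₂ v hreach, G.ae_consistent σ₁ σ₂ v]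
        with ω ⟨i, hi⟩ hc
      refine tendsto_const_nhds.congr' ?_
      filter_upwards [eventually_ge_atTop i] with m hm
      rw [terminal_stable (mem_paths_of_consistent hc) hi hm, hterm _ hi]
  have h2 := (ENNReal.summable (f := fun i => ∫⁻ ω, ρ (ω i) ∂(G.prob σ₁ σ₂ v))).hasSum
    |>.tendsto_sum_nat
  refine ge_of_tendsto' (by simpa using h2.add h1) fun n => G.le_sum_lintegral_add σ₁ σ₂ v ρ y hy n

end Prob

end StochGame

namespace StochGame

/-! ### Positional strategies. -/

section Positional

variable {V : Type*} [Fintype V] (G : StochGame V)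

/-- The deterministic memoryless strategy given by a choice of successors. -/
noncomputable def positional (i : Owner) (c : V → V) (hc : ∀ v, c v ∈ G.post v) :
    G.Strategy i where
  dist _ v := PMF.pure (c v)
  dist_support h v := by
    intro w hw
    rw [PMF.mem_support_pure_iff] at hw
    exact hw ▸ hc _

theorem positional_isDeterministic (i : Owner) (c : V → V) (hc : ∀ v, c v ∈ G.post v) :
    (G.positional i c hc).IsDeterministic := fun _ v => ⟨c v, rfl⟩

theorem positional_isMemoryless (i : Owner) (c : V → V) (hc : ∀ v, c v ∈ G.post v) :
    (G.positional i c hc).IsMemoryless := fun _ _ => rfl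

theorem post_eq_of_mem_terminal {v : V} (hv : v ∈ G.terminal) : G.post v = {v} := by
  ext w
  refine ⟨fun hw => ?_, fun hw => ?_⟩
  · by_contra hne
    have h : 0 < G.δ v w := hw
    rw [hv.2 w hne] at h
    exact lt_irrefl _ h
  · rw [Set.mem_singleton_iff.1 hw]
    change 0 < G.δ v v
    rw [hv.1]; exact one_pos

theorem sum_delta {v : V} (hv : G.owner v = Owner.chance) : ∑ w, (G.δ v w : ℝ≥0∞) = 1 := by
  rw [← ENNReal.ofNNReal_finsetSum, G.δ_chance v hv, ENNReal.coe_one]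

end Positional

/-! ### Existence of a fair strategy. -/

section RoundRobin

theorem exists_enum_frequently {α : Type*} [Finite α] [Nonempty α] :
    ∃ e : ℕ → α, ∀ a, ∃ᶠ n in atTop, e n = a := by
  obtain ⟨g, hg⟩ := exists_surjective_nat α
  refine ⟨fun n => g n.unpair.2, fun a => ?_⟩
  obtain ⟨k, rfl⟩ := hg a
  refine frequently_atTop.2 fun N => ⟨Nat.pair N k, Nat.left_le_pair _ _, ?_⟩
  simp

open Classical in
theorem countP_ofFn {α : Type*} (ω : ℕ → α) (a : α) (n : ℕ) :
    (List.ofFn fun i : Fin n => ω i).countP (fun b => decide (b = a)) =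
      Nat.count (fun i => ω i = a) n := by
  induction n with
  | zero => simp
  | succ n ih =>
    rw [List.ofFn_succ', List.concat_eq_append, List.countP_append, Nat.count_succ]
    simp only [Fin.val_castSucc, Fin.val_last, ih]
    congr 1
    by_cases h : ω n = a <;> simp [h]

variable {V : Type*} [Fintype V] (G : StochGame V)

open Classical in
/-- The strategy that at its `k`-th visit to `v` moves to `e v k`. -/
noncomputable def enumStrategy (i : Owner) (e : ∀ v, ℕ → G.post v) : G.Strategy i where
  dist h v := PMF.pure (e v (h.countP fun b => decide (b = (v : V))))
  dist_support h v := by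
    intro w hw
    rw [PMF.mem_support_pure_iff] at hw
    exact hw ▸ Subtype.property _

variable [MeasurableSpace V] [DiscreteMeasurableSpace V]

/-- Without a fair strategy the stopping hypothesis would be vacuous. Successive visits to a vertex
follow an enumeration that lists each successor infinitely often. -/
theorem exists_isFair : ∃ σ₂ : G.Strategy Owner.player2, σ₂.IsFair := by
  classical
  have hne : ∀ v, Nonempty (G.post v) := fun v => (G.post_nonempty v).elim fun w hw => ⟨w, hw⟩
  choose e he using fun v => exists_enum_frequently (α := G.post v)
  refine ⟨G.enumStrategy Owner.player2 e, fun σ₁ v => prob_eq_one_of_ae ?_⟩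
  filter_upwards [G.ae_consistent σ₁ (G.enumStrategy Owner.player2 e) v] with ω hω
  refine ⟨mem_paths_of_consistent hω, fun u hu hinf w hw => ?_⟩
  have hset : {i | ω i = u}.Infinite := Nat.frequently_atTop_iff_infinite.1 hinf
  refine frequently_atTop.2 fun N => ?_
  obtain ⟨k, hk, hek⟩ := frequently_atTop.1 (he u ⟨w, hw⟩) N
  refine ⟨Nat.nth (fun i => ω i = u) k + 1, ?_, ?_⟩
  · exact hk.trans ((Nat.nth_strictMono hset).le_apply.trans (Nat.le_succ _))
  · have hn : ω (Nat.nth (fun i => ω i = u) k) = u := Nat.nth_mem_of_infinite hset k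
    have := hω (Nat.nth (fun i => ω i = u) k)
    rw [step_player2 _ _ _ _ (hn.symm ▸ hu)] at this
    simp only [enumStrategy, PMF.mem_support_pure_iff, countP_ofFn] at this
    rw [this]
    simp only [hn]
    -- The history excludes the current vertex, so visits are numbered from zero, in agreement with
    -- `Nat.nth`.
    rw [Nat.count_nth_of_infinite hset, hn, hek]

end RoundRobin

/-! ### Rank functions and traps. -/

section Rank

/-- The rank is the stage at which a vertex enters the iteration of `S ↦ S ∪ Φ S` from `∅`. The
iteration stabilises, and a nonempty complement of its limit would contradict `h`. -/
theorem exists_rank {V : Type*} [Finite V] {Φ : Set V → Set V} (hΦ : Monotone Φ)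
    (h : ∀ C : Set V, C.Nonempty → ∃ v ∈ C, v ∈ Φ Cᶜ) :
    ∃ rank : V → ℕ, ∀ v, v ∈ Φ {w | rank w < rank v} := by
  classical
  let W : ℕ → Set V := fun n => Nat.rec ∅ (fun _ S => S ∪ Φ S) n
  have hW : ∀ n, W (n + 1) = W n ∪ Φ (W n) := fun n => rfl
  have hmono : Monotone W := monotone_nat_of_le_succ fun n => by
    rw [hW]; exact Set.subset_union_left
  obtain ⟨N, hN⟩ := WellFoundedGT.monotone_chain_condition (α := Set V) ⟨W, hmono⟩
  have huniv : ∀ v, ∃ n, v ∈ W n := by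
    intro v
    by_contra hv
    obtain ⟨u, hu, hu'⟩ := h (W N)ᶜ ⟨v, fun hvN => hv ⟨N, hvN⟩⟩
    rw [compl_compl] at hu'
    apply hu
    have : W N = W (N + 1) := hN (N + 1) (Nat.le_succ N)
    rw [this, hW]
    exact Or.inr hu'
  have hleast : ∀ v, ∃ n, v ∈ W n ∧ ∀ m, v ∈ W m → n ≤ m := fun v =>
    ⟨sInf {n | v ∈ W n}, Nat.sInf_mem (huniv v), fun m hm => Nat.sInf_le hm⟩
  choose rank hmem hmin using hleast
  refine ⟨rank, fun v => ?_⟩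
  have hv := hmem v
  rcases hk : rank v with _ | k
  · rw [hk] at hv; exact hv.elim
  · rw [hk, hW] at hv
    rcases hv with hv | hv
    · have := hmin v k hv
      omega
    · exact hΦ (fun w hw => Nat.lt_succ_of_le (hmin w k hw)) hv

variable {V : Type*} [Fintype V] (G : StochGame V)

/-- The vertices that are terminal or from which, when Player 2 can choose a move among `A`,
the set `S` is reached in one step with positive probability whatever Player 1 does. -/
def progress (A : V → Set V) (S : Set V) : Set V :=
  {v | v ∉ G.terminal → (G.owner v = Owner.player1 → G.post v ⊆ S) ∧
    (G.owner v = Owner.player2 → ∃ w ∈ A v, w ∈ S) ∧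
    (G.owner v = Owner.chance → ∃ w ∈ G.post v, w ∈ S)}

theorem progress_mono (A : V → Set V) : Monotone (G.progress A) := by
  intro S S' h v hv hT
  obtain ⟨h1, h2, h3⟩ := hv hT
  exact ⟨fun ho => (h1 ho).trans h, fun ho => (h2 ho).imp fun w hw => ⟨hw.1, h hw.2⟩,
    fun ho => (h3 ho).imp fun w hw => ⟨hw.1, h hw.2⟩⟩

/-- The moves `A` of Player 2 admit a rank function certifying that a terminal vertex is reached
almost surely. -/
def IsProper (A : V → Set V) : Prop :=
  ∃ rank : V → ℕ, ∀ v, v ∈ G.progress A {w | rank w < rank v}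

theorem isProper_iff (A : V → Set V) :
    G.IsProper A ↔ ∀ C : Set V, C.Nonempty → ∃ v ∈ C, v ∈ G.progress A Cᶜ := by
  refine ⟨?_, exists_rank (G.progress_mono A)⟩
  rintro ⟨rank, hr⟩ C hC
  obtain ⟨v, hv, hmin⟩ := Set.exists_min_image C rank C.toFinite hC
  refine ⟨v, hv, G.progress_mono A ?_ (hr v)⟩
  exact fun w hw hwC => absurd (hmin w hwC) (not_le.2 hw)

variable {G} in
theorem IsProper.exists_positional (h : G.IsProper G.post) :
    ∃ c : V → V, (∀ v, c v ∈ G.post v) ∧ G.IsProper fun v => {c v} := by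
  obtain ⟨rank, hr⟩ := h
  have : ∀ v, ∃ w ∈ G.post v, v ∉ G.terminal → G.owner v = Owner.player2 →
      rank w < rank v := by
    intro v
    by_cases hv : v ∉ G.terminal ∧ G.owner v = Owner.player2
    · obtain ⟨w, hw, hlt⟩ := (hr v hv.1).2.1 hv.2
      exact ⟨w, hw, fun _ _ => hlt⟩
    · obtain ⟨w, hw⟩ := G.post_nonempty v
      exact ⟨w, hw, fun h1 h2 => (hv ⟨h1, h2⟩).elim⟩
  choose c hc hlt using this
  refine ⟨c, hc, rank, fun v hT => ⟨(hr v hT).1, fun ho => ⟨c v, rfl, hlt v hT ho⟩,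
    (hr v hT).2.2⟩⟩

/-- Otherwise some nonempty `C` without terminal vertices is a trap: Player 1 can always stay, and
all moves of Player 2 and of chance stay. Then even a fair opponent never reaches a terminal vertex.
-/
theorem isProper_post [MeasurableSpace V] [DiscreteMeasurableSpace V]
    (hG : G.StoppingUnderFairness) : G.IsProper G.post := by
  rw [isProper_iff]
  by_contra! hcon
  obtain ⟨C, ⟨v, hv⟩, hC⟩ := hcon
  have hT : ∀ u ∈ C, u ∉ G.terminal := fun u hu ht => hC u hu fun h => (h ht).elim
  have hd : ∀ u, ∃ w ∈ G.post u, u ∈ C → G.owner u = Owner.player1 → w ∈ C := by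
    intro u
    by_cases h : ∃ w ∈ G.post u, w ∈ C
    · obtain ⟨w, hw, hwC⟩ := h
      exact ⟨w, hw, fun _ _ => hwC⟩
    · obtain ⟨w, hw⟩ := G.post_nonempty u
      refine ⟨w, hw, fun huC ho => (hC u huC fun _ => ?_).elim⟩
      exact ⟨fun _ z hz hzC => h ⟨z, hz, hzC⟩, by simp [ho], by simp [ho]⟩
  choose d hd hdC using hd
  obtain ⟨σ₂, hσ₂⟩ := G.exists_isFair
  have hreach := G.ae_reachTerminal (G.positional Owner.player1 d hd) σ₂ v (hG _ σ₂ hσ₂ v)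
  obtain ⟨ω, ⟨i, hi⟩, hω, h0⟩ := (hreach.and ((G.ae_consistent (G.positional Owner.player1 d hd)
    σ₂ v).and (G.prob_zero_eq (G.positional Owner.player1 d hd) σ₂ v))).exists
  have hmem : ∀ n, ω n ∈ C := by
    intro n
    induction n with
    | zero => rwa [h0]
    | succ n ih =>
      have hn := hω n
      rcases ho : G.owner (ω n) with _ | _ | _
      · rw [step_player1 _ _ _ _ ho] at hn
        simp only [positional, PMF.mem_support_pure_iff] at hn
        rw [hn]
        exact hdC _ ih ho
      all_goals
        by_contra hout
        refine hC _ ih fun _ => ?_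
        simpa [ho] using ⟨_, mem_paths_of_consistent hω n, hout⟩
  exact hT _ (hmem i) hi

end Rank

end StochGame

namespace StochGame

/-! ### Bellman operators and policy improvement. -/

section Bellman

variable {V : Type*} [Fintype V] (G : StochGame V)

/-- The value of the next vertex for an estimate `f` of the values, when Player 1 moves optimally and
Player 2 plays the positional strategy `c`. -/
noncomputable def nextValue (c : V → V) (f : V → ℝ≥0∞) (v : V) : ℝ≥0∞ :=
  match G.owner v with
  | Owner.player1 => ⨆ w ∈ G.post v, f w
  | Owner.player2 => f (c v)
  | Owner.chance => ∑ w, G.δ v w * f w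

theorem nextValue_mono (c : V → V) {f g : V → ℝ≥0∞} (hfg : f ≤ g) (v : V) :
    G.nextValue c f v ≤ G.nextValue c g v := by
  unfold nextValue
  split
  · exact iSup₂_mono fun w _ => hfg w
  · exact hfg _
  · gcongr with w
    exact hfg w

open Classical in
/-- The Bellman operator of the one-player game in which Player 2 plays the positional strategy
`c`, for the reward function `ρ`. -/
noncomputable def bellman (ρ : V → ℝ≥0∞) (c : V → V) : (V → ℝ≥0∞) →o (V → ℝ≥0∞) where
  toFun f v := if v ∈ G.terminal then 0 else ρ v + G.nextValue c f v
  monotone' f g hfg v := by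
    dsimp only
    split_ifs
    · exact le_rfl
    · gcongr
      exact G.nextValue_mono c hfg v

variable {G} {ρ f : V → ℝ≥0∞} {c : V → V} {v : V}

theorem bellman_terminal (hT : v ∈ G.terminal) : G.bellman ρ c f v = 0 := if_pos hT

theorem bellman_of_notMem (hT : v ∉ G.terminal) :
    G.bellman ρ c f v = ρ v + G.nextValue c f v := if_neg hT

theorem bellman_player1 (hT : v ∉ G.terminal) (ho : G.owner v = Owner.player1) :
    G.bellman ρ c f v = ρ v + ⨆ w ∈ G.post v, f w := by
  simp only [bellman_of_notMem hT, nextValue, ho]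

theorem bellman_player2 (hT : v ∉ G.terminal) (ho : G.owner v = Owner.player2) :
    G.bellman ρ c f v = ρ v + f (c v) := by
  simp only [bellman_of_notMem hT, nextValue, ho]

theorem bellman_chance (hT : v ∉ G.terminal) (ho : G.owner v = Owner.chance) :
    G.bellman ρ c f v = ρ v + ∑ w, G.δ v w * f w := by
  simp only [bellman_of_notMem hT, nextValue, ho]

theorem add_sum_step_le_of_bellman_le (hc : ∀ v, c v ∈ G.post v)
    (hρ : ∀ v ∈ G.terminal, ρ v = 0) (hf : G.bellman ρ c f ≤ f)
    (σ₁ : G.Strategy Owner.player1) (h : List V) (u : V) :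
    ρ u + ∑ w, G.step σ₁ (G.positional Owner.player2 c hc) h u w * f w ≤ f u := by
  have hsupp := G.step_support σ₁ (G.positional Owner.player2 c hc) h u
  by_cases hT : u ∈ G.terminal
  · rw [hρ u hT, zero_add]
    refine PMF.sum_mul_le_of_support _ _ fun w hw => ?_
    have : w ∈ G.post u := hsupp hw
    rw [G.post_eq_of_mem_terminal hT] at this
    rw [Set.mem_singleton_iff.1 this]
  refine le_trans ?_ (hf u)
  rcases ho : G.owner u with _ | _ | _
  · rw [bellman_player1 hT ho]
    gcongr
    exact PMF.sum_mul_le_of_support _ _ fun w hw => le_iSup₂ (f := fun w _ => f w) w (hsupp hw)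
  · rw [bellman_player2 hT ho]
    gcongr
    refine PMF.sum_mul_le_of_support _ _ fun w hw => ?_
    rw [step_player2 _ _ _ _ ho] at hw
    simp only [positional, PMF.mem_support_pure_iff] at hw
    rw [hw]
  · rw [bellman_chance hT ho]
    simp only [step_chance _ _ _ _ ho, le_refl]

theorem exists_pos_le_delta (G : StochGame V) :
    ∃ ε : ℝ, 0 < ε ∧ ε ≤ 1 / 2 ∧ ∀ v w, 0 < G.δ v w → 2 * ε ≤ G.δ v w := by
  have h1 : ∀ᶠ ε : ℝ in nhdsWithin 0 (Set.Ioi 0),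
      ∀ v w, 0 < G.δ v w → 2 * ε ≤ G.δ v w := by
    refine eventually_all.2 fun v => eventually_all.2 fun w => ?_
    by_cases h : 0 < G.δ v w
    · have h' : (0 : ℝ) < G.δ v w / 2 := by positivity
      filter_upwards [Ioo_mem_nhdsGT h'] with ε hε _
      linarith [hε.2]
    · exact Eventually.of_forall fun _ h' => (h h').elim
  have h2 : ∀ᶠ ε : ℝ in nhdsWithin 0 (Set.Ioi 0), ε ∈ Set.Ioo (0 : ℝ) (1 / 2) :=
    Ioo_mem_nhdsGT (by norm_num)
  obtain ⟨ε, hε, hε'⟩ := (h1.and h2).exists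
  exact ⟨ε, hε'.1, hε'.2.le, hε⟩

/-- The potential is `y = A * (1 - ε ^ rank)`. A lower-rank successor has deficit `A - y` at least
`1 / ε` times larger; being hit with probability at least `2 * ε`, it alone makes the mean deficit
at least double. The gain is at least `A * ε ^ rank`, which is at least `R` by the choice of `A`. -/
theorem IsProper.exists_potential (h : G.IsProper fun v => {c v}) (R : ℝ≥0) :
    ∃ y : V → ℝ≥0, G.bellman (fun _ => R) c (fun v => (y v : ℝ≥0∞)) ≤ fun v => (y v : ℝ≥0∞) := by
  classical
  obtain ⟨rank, hr⟩ := h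
  obtain ⟨ε, hε0, hε2, hδ⟩ := G.exists_pos_le_delta
  obtain ⟨N, hN⟩ : ∃ N, ∀ v, rank v ≤ N :=
    ⟨∑ v, rank v, fun v => Finset.single_le_sum (f := rank) (fun _ _ => zero_le)
      (Finset.mem_univ v)⟩
  have hε1 : ε ≤ 1 := by linarith
  set A : ℝ := R / ε ^ N with hA
  have hA0 : 0 ≤ A := by positivity
  have hRA : ∀ v, R ≤ A * ε ^ rank v := by
    intro v
    rw [hA, div_mul_eq_mul_div, le_div_iff₀ (by positivity)]
    exact mul_le_mul_of_nonneg_left (pow_le_pow_of_le_one hε0.le hε1 (hN v)) R.2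
  let y : V → ℝ≥0 := fun v => (A * (1 - ε ^ rank v)).toNNReal
  have hy : ∀ v, (y v : ℝ) = A * (1 - ε ^ rank v) := fun v =>
    Real.coe_toNNReal _ (mul_nonneg hA0 (by linarith [pow_le_one₀ (n := rank v) hε0.le hε1]))
  have hyA : ∀ v, (y v : ℝ) ≤ A := fun v => by
    rw [hy]; nlinarith [mul_nonneg hA0 (pow_nonneg hε0.le (rank v))]
  have hylt : ∀ v w, rank w < rank v → ∃ E : ℝ, R ≤ ε * (A * E) ∧ 0 ≤ A * E ∧
      (y v : ℝ) = A - ε * (A * E) ∧ (y w : ℝ) ≤ A - A * E := by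
    intro v w hlt
    obtain ⟨k, hk⟩ : ∃ k, rank v = k + 1 := ⟨rank v - 1, by omega⟩
    refine ⟨ε ^ k, ?_, by positivity, ?_, ?_⟩
    · have := hRA v
      rw [hk, pow_succ] at this
      linarith
    · rw [hy, hk, pow_succ]; ring
    · rw [hy]
      have := mul_le_mul_of_nonneg_left (pow_le_pow_of_le_one hε0.le hε1
        (show rank w ≤ k by omega)) hA0
      linarith
  have hstep : ∀ v w, rank w < rank v → R + y w ≤ y v := by
    intro v w hlt
    obtain ⟨E, h1, h2, h3, h4⟩ := hylt v w hlt
    rw [← NNReal.coe_le_coe, NNReal.coe_add]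
    -- Here `ε ≤ 1 / 2` gives `A * E - ε * (A * E) ≥ ε * (A * E) ≥ R`.
    nlinarith
  refine ⟨y, fun v => ?_⟩
  by_cases hT : v ∈ G.terminal
  · rw [bellman_terminal hT]; exact zero_le
  obtain ⟨p1, p2, p3⟩ := hr v hT
  rcases ho : G.owner v with _ | _ | _
  · rw [bellman_player1 hT ho, ENNReal.add_biSup (s := G.post v) (G.post_nonempty v)]
    refine iSup₂_le fun w hw => ?_
    change (R : ℝ≥0∞) + y w ≤ y v
    exact_mod_cast hstep v w (p1 ho hw)
  · rw [bellman_player2 hT ho]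
    obtain ⟨w, rfl, hw⟩ := p2 ho
    change (R : ℝ≥0∞) + y (c v) ≤ y v
    exact_mod_cast hstep v _ hw
  · rw [bellman_chance hT ho]
    obtain ⟨w₀, hw₀, hlt⟩ := p3 ho
    obtain ⟨E, h1, h2, h3, h4⟩ := hylt v w₀ hlt
    have : R + ∑ w, G.δ v w * y w ≤ y v := by
      rw [← NNReal.coe_le_coe, NNReal.coe_add, NNReal.coe_sum, h3]
      have hs : ∑ w, ((G.δ v w * y w : ℝ≥0) : ℝ) ≤
          ∑ w, ((G.δ v w : ℝ) * A - if w = w₀ then (G.δ v w : ℝ) * (A * E) else 0) := by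
        refine Finset.sum_le_sum fun w _ => ?_
        rw [NNReal.coe_mul]
        split_ifs with hw
        · rw [← mul_sub, hw]
          exact mul_le_mul_of_nonneg_left h4 (G.δ v w₀).2
        · rw [sub_zero]
          exact mul_le_mul_of_nonneg_left (hyA w) (G.δ v w).2
      have hδ1 : ∑ w, (G.δ v w : ℝ) = 1 := by exact_mod_cast G.δ_chance v ho
      rw [Finset.sum_sub_distrib, ← Finset.sum_mul, hδ1, Finset.sum_ite_eq' Finset.univ w₀,
        if_pos (Finset.mem_univ _)] at hs
      have := mul_le_mul_of_nonneg_right (hδ v w₀ hw₀) h2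
      linarith
    change (R : ℝ≥0∞) + ∑ w, (G.δ v w : ℝ≥0∞) * y w ≤ y v
    exact_mod_cast this

theorem lfp_bellman_ne_top (h : G.IsProper fun v => {c v}) {ρ : V → ℝ≥0} (v : V) :
    (G.bellman (fun v => ρ v) c).lfp v ≠ ∞ := by
  obtain ⟨y, hy⟩ := h.exists_potential (∑ v, ρ v)
  refine ne_top_of_le_ne_top ENNReal.coe_ne_top (OrderHom.lfp_le _ (le_trans ?_ hy) v)
  intro u
  have hu : (ρ u : ℝ≥0∞) ≤ (∑ v, ρ v : ℝ≥0) := by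
    exact_mod_cast Finset.single_le_sum (f := ρ) (fun _ _ => zero_le) (Finset.mem_univ u)
  by_cases hT : u ∈ G.terminal
  · rw [bellman_terminal hT, bellman_terminal hT]
  · rw [bellman_of_notMem hT, bellman_of_notMem hT]
    gcongr

/-- Switching to a strictly better successor keeps a positional strategy proper. -/
theorem IsProper.update [DecidableEq V] (h : G.IsProper fun v => {c v}) (hf : ∀ v, f v ≠ ∞)
    (hfix : G.bellman ρ c f = f) {v₀ w₀ : V} (hw₀ : f w₀ < f (c v₀)) :
    G.IsProper fun v => {Function.update c v₀ w₀ v} := by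
  rw [isProper_iff] at h ⊢
  by_contra! hcon
  obtain ⟨C, hCne, hC⟩ := hcon
  -- Given a trap `C` for the new choice, let `M ⊆ C` be where `f` is minimal on `C`. The old choice
  -- makes progress out of `M` at some `v`. As `f` is a fixed point and `ρ ≥ 0`, the next value is
  -- at most `f v`, so progress out of `M` is progress out of `C`.
  obtain ⟨m, hm, hmin⟩ := Set.exists_min_image C f C.toFinite hCne
  obtain ⟨v, ⟨hvC, hvm⟩, hv⟩ := h {v | v ∈ C ∧ f v = f m} ⟨m, hm, rfl⟩
  have hT : v ∉ G.terminal := fun hT => hC v hvC fun hT' => (hT' hT).elim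
  obtain ⟨h1, h2, h3⟩ := hv hT
  refine hC v hvC fun _ => ?_
  have hfv := congrFun hfix v
  have hmem : ∀ w ∈ C, f w ≤ f v → w ∈ {v | v ∈ C ∧ f v = f m} := fun w hw hle =>
    ⟨hw, le_antisymm (hle.trans hvm.le) (hmin w hw)⟩
  rcases ho : G.owner v with _ | _ | _
  · refine ⟨fun _ w hw hwC => h1 ho hw (hmem w hwC ?_), by simp, by simp⟩
    rw [← hfv, bellman_player1 hT ho]
    exact (le_iSup₂ (f := fun w _ => f w) w hw).trans le_add_self
  · refine ⟨by simp, fun _ => ⟨_, rfl, fun hwC => ?_⟩, by simp⟩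
    rw [bellman_player2 hT ho] at hfv
    rcases eq_or_ne v v₀ with rfl | hne
    · rw [Function.update_self] at hwC
      have : f v ≤ f w₀ := hvm.le.trans (hmin _ hwC)
      -- The new successor has value below the minimum over `C`, so it lies outside `C`.
      exact absurd (this.trans_lt hw₀) (not_lt.2 (hfv ▸ le_add_self))
    · rw [Function.update_of_ne hne] at hwC
      obtain ⟨w, rfl, hw⟩ := h2 ho
      exact hw (hmem _ hwC (hfv ▸ le_add_self))
  · refine ⟨by simp, by simp, fun _ => ?_⟩
    by_contra! hall
    obtain ⟨w, hw, hwM⟩ := h3 ho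
    have hwC : w ∈ C := not_not.1 (hall w hw)
    -- If all successors stayed in `C`, one of them lying above the minimum would push the average
    -- above `f v`.
    have hlt : f v < f w := lt_of_not_ge fun hle => hwM (hmem w hwC hle)
    have hδ : (G.δ v w : ℝ≥0∞) ≠ 0 := by
      have : 0 < G.δ v w := hw
      exact_mod_cast this.ne'
    rw [bellman_chance hT ho] at hfv
    have hle : ∑ u, (G.δ v u : ℝ≥0∞) * f u ≤ ∑ u, (G.δ v u : ℝ≥0∞) * f v := by
      rw [← Finset.sum_mul, G.sum_delta ho, one_mul]
      exact le_add_self.trans hfv.le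
    refine absurd hle (not_le.2 ?_)
    rw [← Finset.add_sum_erase _ _ (Finset.mem_univ w),
      ← Finset.add_sum_erase (a := w) _ (fun u => (G.δ v u : ℝ≥0∞) * f u) (Finset.mem_univ w)]
    refine ENNReal.add_lt_add_of_lt_of_le ?_ ?_ ?_
    · exact ENNReal.sum_ne_top.2 fun u _ => ENNReal.mul_ne_top ENNReal.coe_ne_top (hf v)
    · exact ENNReal.mul_lt_mul_right hδ ENNReal.coe_ne_top hlt
    · refine Finset.sum_le_sum fun u _ => ?_
      by_cases hu : 0 < G.δ v u
      · gcongr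
        exact hvm.le.trans (hmin u (not_not.1 (hall u hu)))
      · simp [nonpos_iff_eq_zero.1 (not_lt.1 hu)]

/-- There is a proper positional strategy of Player 2 that is locally optimal for its own value. -/
theorem exists_optimal (hG : G.IsProper G.post) (ρ : V → ℝ≥0) :
    ∃ c : V → V, (∀ v, c v ∈ G.post v) ∧ G.IsProper (fun v => {c v}) ∧
      ∀ v ∉ G.terminal, G.owner v = Owner.player2 → ∀ w ∈ G.post v,
        (G.bellman (fun v => ρ v) c).lfp (c v) ≤ (G.bellman (fun v => ρ v) c).lfp w := by
  classical
  obtain ⟨c, hc, hmin⟩ := Set.exists_min_image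
    {c : V → V | (∀ v, c v ∈ G.post v) ∧ G.IsProper (fun v => {c v})}
    (fun c => ∑ v, (G.bellman (fun v => ρ v) c).lfp v) (Set.toFinite _) hG.exists_positional
  refine ⟨c, hc.1, hc.2, fun v₀ hT ho w₀ hw₀ => ?_⟩
  by_contra! hlt
  set x := (G.bellman (fun v => ρ v) c).lfp with hx
  have hfix : G.bellman (fun v => ρ v) c x = x := OrderHom.map_lfp _
  have hfin : ∀ v, x v ≠ ∞ := lfp_bellman_ne_top hc.2
  have hprop := hc.2.update hfin hfix hlt
  have hne : ∀ v, v ≠ v₀ →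
      G.bellman (fun v => ρ v) (Function.update c v₀ w₀) x v = x v := by
    intro v hv
    rw [← congrFun hfix v]
    by_cases hT : v ∈ G.terminal
    · rw [bellman_terminal hT, bellman_terminal hT]
    · rw [bellman_of_notMem hT, bellman_of_notMem hT]
      simp only [nextValue, Function.update_of_ne hv]
  have hlt₀ : G.bellman (fun v => ρ v) (Function.update c v₀ w₀) x v₀ < x v₀ := by
    rw [← congrFun hfix v₀, bellman_player2 hT ho, bellman_player2 hT ho, Function.update_self]
    exact ENNReal.add_lt_add_left ENNReal.coe_ne_top hlt
  have hle : G.bellman (fun v => ρ v) (Function.update c v₀ w₀) x ≤ x := by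
    intro v
    rcases eq_or_ne v v₀ with rfl | hv
    · exact hlt₀.le
    · exact (hne v hv).le
  -- Bounding by one further application of the operator, rather than by `x`, makes the inequality
  -- strict at `v₀`.
  have hlfp : (G.bellman (fun v => ρ v) (Function.update c v₀ w₀)).lfp ≤
      G.bellman (fun v => ρ v) (Function.update c v₀ w₀) x :=
    OrderHom.lfp_le _ (OrderHom.mono _ hle)
  refine absurd (hmin (Function.update c v₀ w₀) ⟨fun v => ?_, hprop⟩) (not_le.2 ?_)
  · rcases eq_or_ne v v₀ with rfl | hv
    · rwa [Function.update_self]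
    · rw [Function.update_of_ne hv]; exact hc.1 v
  · rw [← Finset.add_sum_erase _ _ (Finset.mem_univ v₀),
      ← Finset.add_sum_erase (a := v₀) _ x (Finset.mem_univ v₀)]
    exact ENNReal.add_lt_add_of_lt_of_le
      (ne_top_of_le_ne_top (ENNReal.sum_ne_top.2 fun u _ => hfin u)
        (Finset.sum_le_sum fun u _ => (hlfp u).trans (hle u)))
      ((hlfp v₀).trans_lt hlt₀) (Finset.sum_le_sum fun u _ => (hlfp u).trans (hle u))

end Bellman

/-! ### Fairness of proper strategies and the saddle point. -/

section Value

variable {V : Type*} [Fintype V] [MeasurableSpace V] [DiscreteMeasurableSpace V]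
  {G : StochGame V}

/-- The potential for reward 1 bounds the expected time spent outside terminal vertices. Hence
almost every play is absorbed, and only a terminal vertex, its own sole successor, recurs. -/
theorem IsProper.isFair {c : V → V} (h : G.IsProper fun v => {c v}) (hc : ∀ v, c v ∈ G.post v) :
    (G.positional Owner.player2 c hc).IsFair := by
  classical
  intro σ₁ v
  refine prob_eq_one_of_ae ?_
  obtain ⟨y, hy⟩ := h.exists_potential 1
  let ρ : V → ℝ≥0∞ := fun v => if v ∈ G.terminal then 0 else 1
  have hρ : G.bellman ρ c (fun v => (y v : ℝ≥0∞)) ≤ fun v => (y v : ℝ≥0∞) := by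
    intro u
    by_cases hT : u ∈ G.terminal
    · rw [bellman_terminal hT]; exact zero_le
    · refine le_trans (le_of_eq ?_) (hy u)
      simp [bellman_of_notMem hT, hT, ρ]
  have hle := G.lintegral_tsum_le σ₁ (G.positional Owner.player2 c hc) v ρ _
    (add_sum_step_le_of_bellman_le hc (fun u hu => if_pos hu) hρ σ₁)
  have hmeas : Measurable fun ω : ℕ → V => ∑' i, ρ (ω i) :=
    Measurable.tsum fun i => (Measurable.of_discrete (f := ρ)).comp (measurable_pi_apply i)
  filter_upwards [ae_lt_top hmeas (ne_top_of_le_ne_top ENNReal.coe_ne_top hle),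
    G.ae_consistent σ₁ (G.positional Owner.player2 c hc) v] with ω hfin hω
  have hpath := mem_paths_of_consistent hω
  have hreach : ∃ i, ω i ∈ G.terminal := by
    by_contra! hno
    simp [ρ, hno] at hfin
  obtain ⟨i, hi⟩ := hreach
  refine ⟨hpath, fun u _ hu => ?_⟩
  obtain ⟨n, hn, rfl⟩ := frequently_atTop.1 hu i
  rw [terminal_stable hpath hi hn] at hu ⊢
  rw [G.post_eq_of_mem_terminal hi, Set.singleton_subset_iff]
  exact hu

/-- Positional optimal strategies: Player 2 has a fair one and Player 1 has one, with a common
finite value. -/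
theorem exists_saddle (hG : G.StoppingUnderFairness) :
    ∃ (x : V → ℝ≥0∞) (τ₁ : G.Strategy Owner.player1) (τ₂ : G.Strategy Owner.player2),
      (τ₁.IsDeterministic ∧ τ₁.IsMemoryless) ∧
      (τ₂.IsDeterministic ∧ τ₂.IsMemoryless ∧ τ₂.IsFair) ∧ (∀ v, x v ≠ ∞) ∧
      (∀ σ₁ v, G.expectedRew σ₁ τ₂ v ≤ x v) ∧
      ∀ σ₂ : G.Strategy Owner.player2, σ₂.IsFair → ∀ v, x v ≤ G.expectedRew τ₁ σ₂ v := by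
  obtain ⟨c, hc, hprop, hopt⟩ := exists_optimal (G.isProper_post hG) G.reward
  set x := (G.bellman (fun v => G.reward v) c).lfp with hx
  have hfix : G.bellman (fun v => G.reward v) c x = x := OrderHom.map_lfp _
  have hfin : ∀ v, x v ≠ ∞ := lfp_bellman_ne_top hprop
  have hterm : ∀ v ∈ G.terminal, x v = 0 := fun v hv => by
    rw [← congrFun hfix v, bellman_terminal hv]
  -- Player 1 moves greedily for `x`, so the supremum in the Bellman equation is attained.
  have hd : ∀ v, ∃ w ∈ G.post v, ∀ u ∈ G.post v, x u ≤ x w := fun v =>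
    Set.exists_max_image (G.post v) x (Set.toFinite _) (G.post_nonempty v)
  choose d hd hmax using hd
  refine ⟨x, G.positional _ d hd, G.positional _ c hc,
    ⟨G.positional_isDeterministic _ _ _, G.positional_isMemoryless _ _ _⟩,
    ⟨G.positional_isDeterministic _ _ _, G.positional_isMemoryless _ _ _, hprop.isFair hc⟩,
    hfin, fun σ₁ v => ?_, fun σ₂ hσ₂ v => ?_⟩
  · exact G.lintegral_tsum_le σ₁ _ v _ x (add_sum_step_le_of_bellman_le hc
      (fun u hu => by rw [G.reward_terminal u hu, ENNReal.coe_zero]) hfix.le σ₁)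
  · refine G.le_lintegral_tsum _ σ₂ v (fun v => G.reward v) x hfin hterm (hG _ σ₂ hσ₂ v) fun h u => ?_
    by_cases hT : u ∈ G.terminal
    · rw [hterm u hT]; exact zero_le
    have hsupp := G.step_support (G.positional Owner.player1 d hd) σ₂ h u
    refine (congrFun hfix u).ge.trans ?_
    rcases ho : G.owner u with _ | _ | _
    · rw [bellman_player1 hT ho]
      gcongr
      refine (iSup₂_le (hmax u)).trans (PMF.le_sum_mul_of_support _ _ fun w hw => ?_)
      rw [step_player1 _ _ _ _ ho] at hw
      simp only [positional, PMF.mem_support_pure_iff] at hw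
      rw [hw]
    · rw [bellman_player2 hT ho]
      gcongr
      exact PMF.le_sum_mul_of_support _ _ fun w hw => hopt u hT ho w (hsupp hw)
    · rw [bellman_chance hT ho]
      simp only [step_chance _ _ _ _ ho, le_refl]

end Value

end StochGame

theorem mainTheorem7 {V : Type*} [Fintype V] [MeasurableSpace V] [DiscreteMeasurableSpace V]
    (G : StochGame V) (hG : G.StoppingUnderFairness) (v : V) :
    (⨆ σ₁ : G.Strategy Owner.player1,
        ⨅ (σ₂ : G.Strategy Owner.player2) (_ : σ₂.IsFair), G.expectedRew σ₁ σ₂ v)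
      = (⨆ (σ₁ : G.Strategy Owner.player1) (_ : σ₁.IsDeterministic ∧ σ₁.IsMemoryless),
          ⨅ (σ₂ : G.Strategy Owner.player2)
            (_ : σ₂.IsDeterministic ∧ σ₂.IsMemoryless ∧ σ₂.IsFair), G.expectedRew σ₁ σ₂ v) ∧
    (⨆ σ₁ : G.Strategy Owner.player1,
        ⨅ (σ₂ : G.Strategy Owner.player2) (_ : σ₂.IsFair), G.expectedRew σ₁ σ₂ v) ≠ ⊤ := by
  obtain ⟨x, τ₁, τ₂, h₁, h₂, hfin, hle, hge⟩ := StochGame.exists_saddle hG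
  have hL : (⨆ σ₁ : G.Strategy Owner.player1,
      ⨅ (σ₂ : G.Strategy Owner.player2) (_ : σ₂.IsFair), G.expectedRew σ₁ σ₂ v) = x v :=
    le_antisymm (iSup_le fun σ₁ => (iInf₂_le τ₂ h₂.2.2).trans (hle σ₁ v))
      (le_iSup_of_le τ₁ (le_iInf₂ fun σ₂ h => hge σ₂ h v))
  have hR : (⨆ (σ₁ : G.Strategy Owner.player1) (_ : σ₁.IsDeterministic ∧ σ₁.IsMemoryless),
      ⨅ (σ₂ : G.Strategy Owner.player2)
        (_ : σ₂.IsDeterministic ∧ σ₂.IsMemoryless ∧ σ₂.IsFair), G.expectedRew σ₁ σ₂ v) = x v :=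
    le_antisymm (iSup₂_le fun σ₁ _ => (iInf₂_le τ₂ h₂).trans (hle σ₁ v))
      (le_iSup₂_of_le τ₁ h₁ (le_iInf₂ fun σ₂ h => hge σ₂ h.2.2 v))
  exact ⟨hL.trans hR.symm, hL ▸ hfin v⟩
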